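/- Let $q$ be a power of a prime $p$, let $n$ be a positive integer with $\gcd(n,q)=1$, and let $m=\mathrm{ord}_n(q)$ be the multiplicative order of $q$ modulo $n$. Put $$\delta_{\max}=\left\lfloor \frac{n}{q^m-1}\bigl(q^{\lceil m/2\rceil}-1-(q-2)[m\text{ odd}]\bigr)\right\rfloor,$$ where $[m\text{ odd}]$ is $1$ if $m$ is odd and $0$ otherwise, and let $\delta$ be an integer with $2\le\delta\le\delta_{\max}$. Then there is a narrow-sense BCH code $C$ of length $n$ over $\mathbf F_q$ with designed distance $\delta$ such that $C^\perp\subseteq C$ and such that the CSS construction applied to $C^\perp\subseteq C$ yields a quantum stabilizer code $Q$ with parameters $$[[n,\;n-2m\lceil(\delta-1)(1-1/q)\rceil,\;\ge\delta]]_q$$ that is pure to $\delta_{\max}+1$. Here $C$ is the cyclic code with generator polynomial $\prod_{z\in Z}(x-\alpha^z)$, where $\alpha$ is a primitive $n$-th root of unity in $\mathbf F_{q^m}$, $Z=C_1\cup\dots\cup C_{\delta-1}$ and $C_x=\{xq^j\bmod n\mid j\ge 0\}$; and $C^\perp=\{y\in\mathbf F_q^n\mid x\cdot y=0\text{ for all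 }x\in C\}$. On $\mathbf C^{q^n}$ with orthonormal basis $|x\rangle$, $x\in\mathbf F_q^n$, let $X(a)|x\rangle=|x+a\rangle$ and $Z(b)|x\rangle=\omega^{\mathrm{tr}(b\cdot x)}|x\rangle$ for $a,b\in\mathbf F_q^n$, where $\omega=e^{2\pi i/p}$ and $\mathrm{tr}$ is the trace from $\mathbf F_q$ to $\mathbf F_p$. The error group consists of the operators $\omega^cX(a)Z(b)$, $c\in\mathbf F_p$, and the weight of such an operator is the number of coordinates $i$ with $(a_i,b_i)\ne(0,0)$. A stabilizer code is a nonzero subspace that is the joint $+1$-eigenspace of a subgroup of the error group; $Q$ is the joint $+1$-eigenspace of all $X(a)$ and $Z(b)$ with $a,b\in C^\perp$. Parameters $[[n,k,\ge\delta]]_q$ mean that $\dim Q=q^k$ and that $Q$ detects every error $E$ of the error group of weight less than $\delta$, that is, $PEP=\lambda_E P$ for a scalar $\lambda_E$, with $P$ the orthogonal projection onto $Q$. The code $Q$ is pure to $t$ if no nonscalar element of the error group that fixes $Q$ pointwise has weight less than $t$. -/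

import Mathlib

open Polynomial

/-! ### Classical codes -/

/-- The Euclidean dual code `C^⊥ = {y | x ⬝ y = 0 for all x ∈ C}`. -/
def euclideanDual {F : Type*} [Field F] {n : ℕ} (C : Submodule F (Fin n → F)) :
    Submodule F (Fin n → F) where
  carrier := {y | ∀ x ∈ C, x ⬝ᵥ y = 0}
  zero_mem' := fun x _ => dotProduct_zero x
  add_mem' := fun {y z} hy hz x hx => by rw [dotProduct_add, hy x hx, hz x hx, add_zero]
  smul_mem' := fun r y hy x hx => by rw [dotProduct_smul, hy x hx, smul_zero]

/-- The `q`-ary cyclotomic coset `C_x = {x q^k mod n | k ≥ 0}` modulo `n`. -/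
noncomputable def cyclotomicCoset (n q x : ℕ) : Finset ℕ :=
  open Classical in (Finset.range n).filter fun z => ∃ k : ℕ, z = x * q ^ k % n

/-- The defining set `Z = C_b ∪ ⋯ ∪ C_{b+δ-2}`. -/
noncomputable def bchDefiningSet (n q b δ : ℕ) : Finset ℕ :=
  (Finset.Ico b (b + δ - 1)).biUnion fun x => cyclotomicCoset n q x

/-- The polynomial `∏_{z ∈ Z} (x - α^z)`. -/
noncomputable def rootPolynomial {K : Type*} [Field K] (α : K) (Z : Finset ℕ) : K[X] :=
  ∏ z ∈ Z, (X - C (α ^ z))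

/-- The polynomial `c_0 + c_1 x + ⋯ + c_{n-1} x^{n-1}` of a word `c`. -/
noncomputable def wordPolynomial {F : Type*} [Field F] {n : ℕ} (c : Fin n → F) : F[X] :=
  ∑ i : Fin n, C (c i) * X ^ (i : ℕ)

/-- The cyclic code of length `n` over `F` whose generator polynomial is
`g(x) = ∏_{z ∈ Z} (x - α^z)`: the words whose polynomial is a multiple of `g(x)`. The factors of
`g` have their coefficients in an extension field `K` of `F`, so that divisibility is stated
over `K`. -/
noncomputable def cyclicCode (F : Type*) [Field F] {K : Type*} [Field K] [Algebra F K] (n : ℕ)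
    (α : K) (Z : Finset ℕ) : Submodule F (Fin n → F) where
  carrier := {c | rootPolynomial α Z ∣ (wordPolynomial c).map (algebraMap F K)}
  zero_mem' := by simp [wordPolynomial]
  add_mem' := fun {c d} hc hd => by
    have h : wordPolynomial (c + d) = wordPolynomial c + wordPolynomial d := by
      simp [wordPolynomial, add_mul, Finset.sum_add_distrib]
    simp only [Set.mem_ofPred_eq] at hc hd ⊢
    rw [h, Polynomial.map_add]
    exact dvd_add hc hd
  smul_mem' := fun r c hc => by
    have h : wordPolynomial (r • c) = C r * wordPolynomial c := by
      simp [wordPolynomial, Finset.mul_sum, mul_assoc]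
    simp only [Set.mem_ofPred_eq] at hc ⊢
    rw [h, Polynomial.map_mul]
    exact Dvd.dvd.mul_left hc _

/-- `D` is a narrow-sense BCH code of length `n` over `F` with designed distance `δ`, for some
choice of a primitive `n`-th root of unity `α` (which lies in the extension of `F` of degree
`ord_n(q)`, inside the algebraic closure). -/
def IsNarrowSenseBCH {F : Type*} [Field F] [Fintype F] {n : ℕ} (δ : ℕ)
    (D : Submodule F (Fin n → F)) : Prop :=
  ∃ α : AlgebraicClosure F, IsPrimitiveRoot α n ∧
    D = cyclicCode F n α (bchDefiningSet n (Fintype.card F) 1 δ)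

/-! ### Quantum stabilizer codes -/

/-- The state space `(ℂ^q)^{⊗n} = ℂ^{q^n}` of `n` systems of dimension `q = |F|`; its standard
orthonormal basis `|x⟩` is indexed by `x ∈ F^n`. -/
abbrev QState (F : Type*) (n : ℕ) : Type _ := EuclideanSpace ℂ (Fin n → F)

/-- The operator `X(a)`, `X(a) |x⟩ = |x + a⟩`. -/
noncomputable def opX {F : Type*} [Field F] [Fintype F] {n : ℕ} (a : Fin n → F) :
    Module.End ℂ (QState F n) where
  toFun f := WithLp.toLp 2 fun x => f (x - a)
  map_add' _ _ := by ext; simp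
  map_smul' _ _ := by ext; simp

/-- The operator `Z(b)`, `Z(b) |x⟩ = ω^{tr(b ⬝ x)} |x⟩`, where `ω = exp(2πi/p)` and `tr` is the
trace from `F` to `𝔽_p`. -/
noncomputable def opZ (p : ℕ) [Fact p.Prime] {F : Type*} [Field F] [Fintype F]
    [Algebra (ZMod p) F] {n : ℕ} (b : Fin n → F) : Module.End ℂ (QState F n) where
  toFun f := WithLp.toLp 2 fun x =>
    ZMod.stdAddChar (Algebra.trace (ZMod p) F (b ⬝ᵥ x)) * f x
  map_add' _ _ := by ext; simp [mul_add]
  map_smul' _ _ := by ext; simp [mul_left_comm]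

/-- The error operator `ω^c X(a) Z(b)`. -/
noncomputable def errorOp (p : ℕ) [Fact p.Prime] {F : Type*} [Field F] [Fintype F]
    [Algebra (ZMod p) F] {n : ℕ} (c : ZMod p) (a b : Fin n → F) :
    Module.End ℂ (QState F n) :=
  (ZMod.stdAddChar c : ℂ) • (opX a * opZ p b)

theorem errorOp_apply (p : ℕ) [Fact p.Prime] {F : Type*} [Field F] [Fintype F]
    [Algebra (ZMod p) F] {n : ℕ} (c : ZMod p) (a b : Fin n → F) (f : QState F n)
    (x : Fin n → F) :
    errorOp p c a b f x = ZMod.stdAddChar c *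
      (ZMod.stdAddChar (Algebra.trace (ZMod p) F (b ⬝ᵥ (x - a))) * f (x - a)) := by
  simp [errorOp, opX, opZ]

theorem errorOp_zero (p : ℕ) [Fact p.Prime] {F : Type*} [Field F] [Fintype F]
    [Algebra (ZMod p) F] {n : ℕ} : errorOp p (F := F) (n := n) 0 0 0 = 1 := by
  ext f x
  simp [errorOp_apply]

theorem errorOp_mul (p : ℕ) [Fact p.Prime] {F : Type*} [Field F] [Fintype F]
    [Algebra (ZMod p) F] {n : ℕ} (c c' : ZMod p) (a b a' b' : Fin n → F) :
    errorOp p c a b * errorOp p c' a' b' =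
      errorOp p (c + c' + Algebra.trace (ZMod p) F (b ⬝ᵥ a')) (a + a') (b + b') := by
  refine LinearMap.ext fun f => ?_
  ext x
  have h1 : x - a - a' = x - (a + a') := by abel
  have h2 : b ⬝ᵥ (x - a) = b ⬝ᵥ a' + b ⬝ᵥ (x - (a + a')) := by
    rw [← dotProduct_add]; congr 1; abel
  rw [Module.End.mul_apply, errorOp_apply, errorOp_apply, errorOp_apply, h1, h2]
  simp only [add_dotProduct, map_add, AddChar.map_add_eq_mul]
  ring

/-- The error group `G_n = {ω^c X(a) Z(b) | c ∈ 𝔽_p, a, b ∈ F^n}`. -/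
noncomputable def errorGroup (p : ℕ) [Fact p.Prime] (F : Type*) [Field F] [Fintype F]
    [Algebra (ZMod p) F] (n : ℕ) : Subgroup (Module.End ℂ (QState F n))ˣ where
  carrier := {g | ∃ (c : ZMod p) (a b : Fin n → F), (g : Module.End ℂ (QState F n)) =
    errorOp p c a b}
  one_mem' := ⟨0, 0, 0, by rw [errorOp_zero]; rfl⟩
  mul_mem' := by
    rintro g h ⟨c, a, b, hg⟩ ⟨c', a', b', hh⟩
    exact ⟨_, _, _, by rw [Units.val_mul, hg, hh, errorOp_mul]⟩
  inv_mem' := by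
    rintro g ⟨c, a, b, hg⟩
    refine ⟨-c + Algebra.trace (ZMod p) F (b ⬝ᵥ a), -a, -b, ?_⟩
    rw [Units.inv_eq_of_mul_eq_one_right]
    rw [hg, errorOp_mul, ← errorOp_zero p]
    congr 1 <;> simp

/-- The weight of `ω^c X(a) Z(b)`: the number of systems on which it acts by a nonscalar
operator. -/
noncomputable def errorWeight {F : Type*} [Field F] {n : ℕ} (a b : Fin n → F) : ℕ :=
  open Classical in (Finset.univ.filter fun i : Fin n => a i ≠ 0 ∨ b i ≠ 0).card

/-- `Fix(S)`, the joint eigenspace with eigenvalue `1` of the operators in `S`. -/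
def fixedSpace {V : Type*} [AddCommGroup V] [Module ℂ V] (S : Set (Module.End ℂ V)) :
    Submodule ℂ V where
  carrier := {v | ∀ E ∈ S, E v = v}
  zero_mem' := fun E _ => map_zero E
  add_mem' := fun {u v} hu hv E hE => by rw [map_add, hu E hE, hv E hE]
  smul_mem' := fun r v hv E hE => by rw [map_smul, hv E hE]

/-- A stabilizer code: a nonzero subspace `Q = Fix(S)` for some subgroup `S` of the error
group. -/
def IsStabilizerCode (p : ℕ) [Fact p.Prime] {F : Type*} [Field F] [Fintype F]
    [Algebra (ZMod p) F] {n : ℕ} (Q : Submodule ℂ (QState F n)) : Prop :=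
  Q ≠ ⊥ ∧ ∃ S : Subgroup (Module.End ℂ (QState F n))ˣ, S ≤ errorGroup p F n ∧
    Q = fixedSpace (Units.val '' (S : Set (Module.End ℂ (QState F n))ˣ))

/-- `Q` detects the error `E`: `P E P = λ P` for some scalar `λ`, where `P` is the orthogonal
projection onto `Q`; equivalently `⟨u| E |v⟩ = λ ⟨u|v⟩` for all `u, v ∈ Q`. -/
def Detects {F : Type*} [Fintype F] {n : ℕ} (Q : Submodule ℂ (QState F n))
    (E : Module.End ℂ (QState F n)) : Prop :=
  ∃ l : ℂ, ∀ u ∈ Q, ∀ v ∈ Q, inner ℂ u (E v) = l * inner ℂ u v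

/-- `Q` is an `[[n, k, ≥ d]]_q` quantum code with `q = |F|`: a `q^k`-dimensional subspace of
`ℂ^{q^n}` that detects all errors in the error group of weight less than `d`. (The usual
convention for positive `k`.) -/
def IsQuantumCode (p : ℕ) [Fact p.Prime] {F : Type*} [Field F] [Fintype F]
    [Algebra (ZMod p) F] {n : ℕ} (k d : ℕ) (Q : Submodule ℂ (QState F n)) : Prop :=
  Module.finrank ℂ Q = Fintype.card F ^ k ∧
    ∀ (c : ZMod p) (a b : Fin n → F), errorWeight a b < d → Detects Q (errorOp p c a b)

/-- `Q` is pure to `t`: the stabilizer group of `Q`, which consists of the elements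
`ω^c X(a) Z(b)` of the error group that fix every vector of `Q`, contains no nonscalar operator
(`a ≠ 0` or `b ≠ 0`) of weight less than `t`. -/
def PureTo (p : ℕ) [Fact p.Prime] {F : Type*} [Field F] [Fintype F]
    [Algebra (ZMod p) F] {n : ℕ} (t : ℕ) (Q : Submodule ℂ (QState F n)) : Prop :=
  ∀ (c : ZMod p) (a b : Fin n → F), (∀ v ∈ Q, errorOp p c a b v = v) →
    (a ≠ 0 ∨ b ≠ 0) → t ≤ errorWeight a b

/-- The code given by the CSS construction from linear codes `C₁ ⊆ C₂`: the joint eigenspace with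
eigenvalue `1` of the operators `X(a)`, `a ∈ C₁`, and `Z(b)`, `b ∈ C₂^⊥`. -/
noncomputable def cssCode (p : ℕ) [Fact p.Prime] {F : Type*} [Field F] [Fintype F]
    [Algebra (ZMod p) F] {n : ℕ} (C₁ C₂ : Submodule F (Fin n → F)) :
    Submodule ℂ (QState F n) :=
  fixedSpace ({E | ∃ a ∈ C₁, E = opX a} ∪ {E | ∃ b ∈ euclideanDual C₂, E = opZ p b})

/-- `δ_max = ⌊ n / (q^m - 1) ⬝ (q^⌈m/2⌉ - 1 - (q - 2) [m odd]) ⌋`. -/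
def deltaMax (n q m : ℕ) : ℕ :=
  ⌊(n : ℚ) / ((q : ℚ) ^ m - 1) *
    ((q : ℚ) ^ ⌈(m : ℚ) / 2⌉₊ - 1 - ((q : ℚ) - 2) * (if Odd m then 1 else 0))⌋₊

/-! ### Euclidean duality -/

/-! Write `M = q^m - 1 = nN`. Scaling by `N` carries congruences modulo `n` to congruences modulo
`M`, where multiplication by `q` rotates base-`q` digits. The formula for δ_max is chosen so that `X
= (δ_max - 1)N` satisfies `X q^⌊m/2⌋ + X < M`. Hence for `x, y ≤ X` the sum `x q^j + y` does not
wrap around modulo `M` when `j ≤ ⌊m/2⌋`, and a larger exponent `k` is replaced by `m - k`.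

Two facts follow. The cosets of the `x < δ` with `q ∤ x` are distinct and of size `m`
(`card_bchDefiningSet`), which gives the dimension. No `t < δ_max`, including `t = 0`, is the
negative of an element of `Z` (`not_dvd_add_of_mem_bchDefiningSet`). A dual word vanishes at `α^t`
unless `-t ∈ Z`, so `Z ∩ -Z = ∅` gives `C^⊥ ⊆ C`, and the δ_max consecutive zeros at `t = 0, …,
δ_max - 1` give dual distance at least δ_max + 1 by the BCH bound.

On the quantum side, `Q` is the space of functions on `D/D^⊥`, with `D = C`. An error `(a, b)` with
`a` or `b` outside `D` is detected through a stabilizer element that does not commute with it. An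
error fixing `Q` has `a, b ∈ D^⊥`. So the distances of `D` and `D^⊥` give detection and purity. -/

theorem dotProductBilin_nondegenerate (F : Type*) [Field F] (n : ℕ) :
    LinearMap.BilinForm.Nondegenerate (dotProductBilin F F : LinearMap.BilinForm F (Fin n → F)) := by
  refine ⟨fun x hx => dotProduct_eq_zero x hx, fun y hy => dotProduct_eq_zero y fun w => ?_⟩
  rw [dotProduct_comm]; exact hy w

theorem euclideanDual_eq_orthogonal {F : Type*} [Field F] {n : ℕ} (C : Submodule F (Fin n → F)) :
    euclideanDual C =
      LinearMap.BilinForm.orthogonal (dotProductBilin F F : LinearMap.BilinForm F (Fin n → F)) C :=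
  rfl

theorem finrank_euclideanDual {F : Type*} [Field F] {n : ℕ} (C : Submodule F (Fin n → F)) :
    Module.finrank F (euclideanDual C) = n - Module.finrank F C := by
  rw [euclideanDual_eq_orthogonal,
    LinearMap.BilinForm.finrank_orthogonal (dotProductBilin_nondegenerate F n), Module.finrank_fin_fun]

theorem euclideanDual_euclideanDual {F : Type*} [Field F] {n : ℕ}
    (C : Submodule F (Fin n → F)) : euclideanDual (euclideanDual C) = C := by
  rw [euclideanDual_eq_orthogonal, euclideanDual_eq_orthogonal]
  refine LinearMap.BilinForm.orthogonal_orthogonal (dotProductBilin_nondegenerate F n) ?_ C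
  intro x y h
  change y ⬝ᵥ x = 0
  rw [dotProduct_comm]; exact h

/-! ### Cyclotomic cosets -/

theorem mem_bchDefiningSet {n q δ z : ℕ} (hn : 0 < n) :
    z ∈ bchDefiningSet n q 1 δ ↔ ∃ x k, 1 ≤ x ∧ x < δ ∧ z = x * q ^ k % n := by
  simp only [bchDefiningSet, cyclotomicCoset, Finset.mem_biUnion, Finset.mem_Ico,
    Finset.mem_filter, Finset.mem_range, Nat.add_sub_cancel_left]
  constructor
  · rintro ⟨x, ⟨h1, h2⟩, _, k, hk⟩
    exact ⟨x, k, h1, h2, hk⟩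
  · rintro ⟨x, k, h1, h2, hk⟩
    exact ⟨x, ⟨h1, h2⟩, hk ▸ Nat.mod_lt _ hn, k, hk⟩

theorem bchDefiningSet_subset_range (n q b δ : ℕ) :
    bchDefiningSet n q b δ ⊆ Finset.range n := by
  intro z
  simp only [bchDefiningSet, cyclotomicCoset, Finset.mem_biUnion, Finset.mem_filter]
  rintro ⟨_, _, h, _⟩
  exact h

theorem mul_mod_mem_bchDefiningSet {n q δ z : ℕ} (hn : 0 < n)
    (hz : z ∈ bchDefiningSet n q 1 δ) : z * q % n ∈ bchDefiningSet n q 1 δ := by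
  rw [mem_bchDefiningSet hn] at hz ⊢
  obtain ⟨x, k, h1, h2, rfl⟩ := hz
  exact ⟨x, k + 1, h1, h2, by rw [pow_succ, ← mul_assoc, Nat.mod_mul_mod]⟩

theorem mul_pow_modEq_mul_pow_mod {n q m : ℕ} (hm : q ^ m ≡ 1 [MOD n]) (x k : ℕ) :
    x * q ^ k ≡ x * q ^ (k % m) [MOD n] := by
  conv_lhs => rw [← Nat.div_add_mod k m, pow_add, pow_mul]
  simpa using ((hm.pow (k / m)).mul_right (q ^ (k % m))).mul_left x

/-- The elements of a range of small numbers not divisible by `q` lie in distinct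
`q`-cyclotomic cosets modulo `q ^ m - 1`, each of size `m`. -/
theorem eq_of_mul_pow_modEq {q m h M X x y k : ℕ} (hq : 0 < q) (hM : M + 1 = q ^ m)
    (hh : 2 * h ≤ m + 1) (hX : X * q ^ (m - h) + X < M) (hxX : x ≤ X) (hyX : y ≤ X)
    (hx : ¬ q ∣ x) (hy : ¬ q ∣ y) (hk : k < m) (hxy : x * q ^ k ≡ y [MOD M]) :
    k = 0 ∧ x = y := by
  have bound : ∀ {x j : ℕ}, x ≤ X → j ≤ m - h → x * q ^ j < M := fun {x j} hx hj =>
    lt_of_le_of_lt (Nat.mul_le_mul hx (Nat.pow_le_pow_right hq hj)) (by omega)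
  have small : ∀ {x : ℕ}, x ≤ X → x < M := fun {x} hx => by omega
  -- For `k ≤ m - h` both sides are below `M`, so the congruence is an equality. Otherwise multiply
  -- by `q^(m-k)`: then `m - k ≤ h - 1 ≤ m - h`, and the roles of `x` and `y` are exchanged.
  by_cases hkh : k ≤ m - h
  · have e := Nat.ModEq.eq_of_lt_of_lt hxy (bound hxX hkh) (small hyX)
    rcases Nat.eq_zero_or_pos k with rfl | hk0
    · simpa using e
    · exact absurd (e ▸ Dvd.dvd.mul_left (dvd_pow_self q hk0.ne') x) hy
  · have hqm : q ^ m ≡ 1 [MOD M] := by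
      rw [← hM]; simp [Nat.ModEq]
    have e : y * q ^ (m - k) ≡ x [MOD M] := by
      have := hxy.symm.mul_right (q ^ (m - k))
      rw [mul_assoc, ← pow_add, Nat.add_sub_cancel' hk.le] at this
      exact this.trans (by simpa using hqm.mul_left x)
    have e := Nat.ModEq.eq_of_lt_of_lt e (bound hyX (by omega)) (small hxX)
    exact absurd (e ▸ Dvd.dvd.mul_left (dvd_pow_self q (by omega)) y) hx

/-- A small number is not the negative of an element of the coset of another small number. -/
theorem not_dvd_mul_pow_add {q m h M X x y k : ℕ} (hq : 0 < q) (hM : M + 1 = q ^ m)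
    (hh : 2 * h ≤ m + 1) (hX : X * q ^ (m - h) + X < M) (hxX : x ≤ X) (hyX : y ≤ X)
    (hx : 0 < x) (hk : k < m) : ¬ M ∣ x * q ^ k + y := by
  have bound : ∀ {x y j : ℕ}, x ≤ X → y ≤ X → j ≤ m - h → x * q ^ j + y < M :=
    fun {x y j} hx hy hj =>
      lt_of_le_of_lt (Nat.add_le_add (Nat.mul_le_mul hx (Nat.pow_le_pow_right hq hj)) hy) hX
  intro hd
  by_cases hkh : k ≤ m - h
  · exact absurd (Nat.le_of_dvd (by positivity) hd) (bound hxX hyX hkh).not_ge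
  · have hqm : q ^ m ≡ 1 [MOD M] := by
      rw [← hM]; simp [Nat.ModEq]
    have e : M ∣ y * q ^ (m - k) + x := by
      have h1 := hd.mul_right (q ^ (m - k))
      rw [add_mul, mul_assoc, ← pow_add, Nat.add_sub_cancel' hk.le, add_comm] at h1
      exact (Nat.ModEq.dvd_iff ((hqm.mul_left x).add_left _) dvd_rfl).1 h1 |>.trans (by simp)
    exact absurd (Nat.le_of_dvd (by positivity) e) (bound hyX hxX (by omega)).not_ge

/-- The numerical data behind the hypothesis `2 ≤ deltaMax n q m`. -/
theorem exists_of_two_le_deltaMax {n q m : ℕ} (hq : 2 ≤ q) (hqm : q ^ m ≡ 1 [MOD n])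
    (hd : 2 ≤ deltaMax n q m) :
    0 < n ∧ 0 < m ∧ ∃ N M h : ℕ, M + 1 = q ^ m ∧ n * N = M ∧ 0 < N ∧ 2 * h ≤ m + 1 ∧
      ((deltaMax n q m - 1) * N) * q ^ (m - h) + (deltaMax n q m - 1) * N < M := by
  -- The degenerate cases make δ_max zero: `n = 0` kills the prefactor, and for `m = 0` the
  -- denominator `q^m - 1` is zero, so the quotient is zero by convention.
  have hn : 0 < n := by
    rcases Nat.eq_zero_or_pos n with rfl | h
    · simp [deltaMax] at hd
    · exact h
  have hm : 0 < m := by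
    rcases Nat.eq_zero_or_pos m with rfl | h
    · simp [deltaMax] at hd
    · exact h
  have h1 : 1 < q ^ m := Nat.one_lt_pow hm.ne' hq
  obtain ⟨N, hN⟩ : n ∣ q ^ m - 1 := (Nat.modEq_iff_dvd' h1.le).1 hqm.symm
  have hN0 : 0 < N := by
    rcases Nat.eq_zero_or_pos N with rfl | h
    · simp at hN; omega
    · exact h
  refine ⟨hn, hm, N, q ^ m - 1, (m + 1) / 2, by omega, hN.symm, hN0, by omega, ?_⟩
  set d := deltaMax n q m with hdd
  have hceil : ⌈(m : ℚ) / 2⌉₊ = (m + 1) / 2 := by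
    rw [Nat.ceil_eq_iff (by omega)]
    have h2 : 2 * ((m + 1) / 2) ≤ m + 1 := by omega
    have h3 : m ≤ 2 * ((m + 1) / 2) := by omega
    have h4 : 1 ≤ (m + 1) / 2 := by omega
    have h2' : (2 : ℚ) * ((m + 1) / 2 : ℕ) ≤ m + 1 := by exact_mod_cast h2
    have h3' : (m : ℚ) ≤ 2 * ((m + 1) / 2 : ℕ) := by exact_mod_cast h3
    push_cast [Nat.cast_sub h4]
    constructor <;> linarith
  have hle : (d : ℚ) ≤ (n : ℚ) / ((q : ℚ) ^ m - 1) *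
      ((q : ℚ) ^ ((m + 1) / 2) - 1 - ((q : ℚ) - 2) * (if Odd m then 1 else 0)) := by
    rw [← hceil]
    exact (Nat.le_floor_iff' (by omega)).1 le_rfl
  have hNQ : (n : ℚ) * N = (q : ℚ) ^ m - 1 := by
    have : n * N + 1 = q ^ m := by omega
    rw [eq_sub_iff_add_eq]; exact_mod_cast this
  have hnQ : (0 : ℚ) < n := by exact_mod_cast hn
  have hNQ0 : (0 : ℚ) < N := by exact_mod_cast hN0
  have hdN : (d : ℚ) * N ≤
      (q : ℚ) ^ ((m + 1) / 2) - 1 - ((q : ℚ) - 2) * (if Odd m then 1 else 0) := by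
    rw [← hNQ, ← div_div, div_self hnQ.ne', one_div, inv_mul_eq_div, le_div_iff₀ hNQ0] at hle
    exact hle
  obtain ⟨e, he⟩ : ∃ e, d = e + 1 := ⟨d - 1, by omega⟩
  have hXN : d * N = (d - 1) * N + N := by rw [he]; simp [add_mul]
  set X := (d - 1) * N
  have hdX : (d : ℚ) * N = X + N := by exact_mod_cast hXN
  have hN1 : (1 : ℚ) ≤ N := by exact_mod_cast hN0
  suffices X * q ^ (m - (m + 1) / 2) + X + 1 < q ^ m by omega
  -- For `m = 2t`, `X ≤ q^t - 2` suffices. For `m = 2t + 1` the correction `q - 2` gives `X ≤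
  -- q^(t+1) - q`, and then `X(q^t + 1) ≤ q^m - q`.
  rcases Nat.even_or_odd' m with ⟨t, rfl | rfl⟩
  · have e1 : (2 * t + 1) / 2 = t := by omega
    rw [e1] at hdN ⊢
    rw [if_neg (by simp)] at hdN
    have hX : X + 2 ≤ q ^ t := by
      have : (X : ℚ) + 2 ≤ q ^ t := by linarith
      exact_mod_cast this
    have e2 : 2 * t - t = t := by omega
    rw [e2, mul_comm 2 t, pow_mul]
    nlinarith
  · have e1 : (2 * t + 1 + 1) / 2 = t + 1 := by omega
    rw [e1] at hdN ⊢
    rw [if_pos (by simp)] at hdN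
    have hX : X + q ≤ q ^ (t + 1) := by
      have : (X : ℚ) + q ≤ q ^ (t + 1) := by linarith
      exact_mod_cast this
    have e2 : 2 * t + 1 - (t + 1) = t := by omega
    have e3 : q ^ (2 * t + 1) = q ^ t * q ^ (t + 1) := by rw [← pow_add]; congr 1; omega
    rw [e2, e3]
    rw [pow_succ] at hX ⊢
    nlinarith [Nat.zero_le (q ^ t)]

/-- Dividing out powers of `q` gives each coset a representative below `δ` not divisible by `q`. The
map `(x, k) ↦ x q^k mod n` on such `x` and `k < m` is injective by `eq_of_mul_pow_modEq` after
scaling by `N`; since `N` is coprime to `q`, scaling preserves `q ∤ x`. -/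
theorem card_bchDefiningSet {n q m δ : ℕ} (hq : 2 ≤ q) (hn : Nat.Coprime n q)
    (hqm : q ^ m ≡ 1 [MOD n]) (hδ : 2 ≤ δ) (hδmax : δ ≤ deltaMax n q m) :
    (bchDefiningSet n q 1 δ).card = ((Finset.Ico 1 δ).filter fun x => ¬ q ∣ x).card * m := by
  obtain ⟨hn0, hm0, N, M, h, hM, hnN, hN0, hh, hX⟩ :=
    exists_of_two_le_deltaMax hq hqm (hδ.trans hδmax)
  have hNq : Nat.Coprime q N := by
    have h1 : N ∣ q ^ m - 1 := ⟨n, by rw [mul_comm N, hnN]; omega⟩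
    have h2 : Nat.Coprime (q ^ m - 1) (q ^ m) := by
      rw [Nat.coprime_self_sub_left (by omega)]; simp
    exact (Nat.Coprime.coprime_dvd_left h1
      ((Nat.coprime_pow_right_iff hm0 _ _).1 h2)).symm
  have hle : ∀ {x}, x < δ → x * N ≤ (deltaMax n q m - 1) * N := fun {x} hx =>
    Nat.mul_le_mul_right _ (by omega)
  have hnd : ∀ {x}, ¬ q ∣ x → ¬ q ∣ x * N := fun {x} hx h' => hx (hNq.dvd_of_dvd_mul_right h')
  have key : ∀ {x y k l : ℕ}, x < δ → y < δ → ¬ q ∣ x → ¬ q ∣ y → k < m → l ≤ k →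
      x * q ^ k ≡ y * q ^ l [MOD n] → x = y ∧ k = l := by
    intro x y k l hx hy hqx hqy hk hl e
    obtain ⟨j, rfl⟩ := Nat.exists_eq_add_of_le hl
    have e1 : x * q ^ j * q ^ l ≡ y * q ^ l [MOD n] := by
      rwa [mul_assoc, ← pow_add, add_comm j l]
    have e2 := Nat.ModEq.cancel_right_of_coprime (hn.pow_right l) e1
    have e3 := Nat.ModEq.mul_right' N e2
    rw [hnN, mul_right_comm] at e3
    obtain ⟨rfl, e4⟩ := eq_of_mul_pow_modEq (by omega) hM hh hX (hle hx) (hle hy) (hnd hqx)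
      (hnd hqy) (by omega) e3
    exact ⟨Nat.eq_of_mul_eq_mul_right hN0 e4, rfl⟩
  have himage : bchDefiningSet n q 1 δ =
      (((Finset.Ico 1 δ).filter fun x => ¬ q ∣ x) ×ˢ Finset.range m).image
        fun w => w.1 * q ^ w.2 % n := by
    ext z
    rw [mem_bchDefiningSet hn0]
    simp only [Finset.mem_image, Finset.mem_product, Finset.mem_filter, Finset.mem_Ico,
      Finset.mem_range, Prod.exists]
    constructor
    · rintro ⟨x, k, h1, h2, rfl⟩
      obtain ⟨s, y, hy, rfl⟩ := Nat.exists_eq_pow_mul_and_not_dvd (show x ≠ 0 by omega) q (by omega)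
      have hy0 : 1 ≤ y := Nat.one_le_iff_ne_zero.2 (by rintro rfl; simp at hy)
      have hyx : y ≤ q ^ s * y := Nat.le_mul_of_pos_left _ (by positivity)
      refine ⟨y, (s + k) % m, ⟨⟨⟨hy0, by omega⟩, hy⟩, Nat.mod_lt _ hm0⟩, ?_⟩
      have := (mul_pow_modEq_mul_pow_mod hqm y (s + k)).symm
      rw [this, pow_add]
      congr 1; ring
    · rintro ⟨x, k, ⟨⟨⟨h1, h2⟩, _⟩, _⟩, rfl⟩
      exact ⟨x, k, h1, h2, rfl⟩
  rw [himage, Finset.card_image_of_injOn, Finset.card_product, Finset.card_range]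
  rintro ⟨x, k⟩ hx ⟨y, l⟩ hy e
  simp only [Finset.coe_product, Set.mem_prod, Finset.mem_coe, Finset.mem_filter, Finset.mem_Ico,
    Finset.mem_range] at hx hy
  rcases le_total l k with hl | hl
  · obtain ⟨rfl, rfl⟩ := key hx.1.1.2 hy.1.1.2 hx.1.2 hy.1.2 hx.2 hl e
    rfl
  · obtain ⟨rfl, rfl⟩ := key hy.1.1.2 hx.1.1.2 hy.1.2 hx.1.2 hy.2 hl (Nat.ModEq.symm e)
    rfl

/-- The range of `t` reaches δ_max rather than `δ`; this is why purity does not depend on `δ`. -/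
theorem not_dvd_add_of_mem_bchDefiningSet {n q m δ z t : ℕ} (hq : 2 ≤ q)
    (hqm : q ^ m ≡ 1 [MOD n]) (hδ : 2 ≤ δ) (hδmax : δ ≤ deltaMax n q m)
    (hz : z ∈ bchDefiningSet n q 1 δ) (ht : t < deltaMax n q m) : ¬ n ∣ t + z := by
  obtain ⟨hn0, hm0, N, M, h, hM, hnN, hN0, hh, hX⟩ :=
    exists_of_two_le_deltaMax hq hqm (hδ.trans hδmax)
  rw [mem_bchDefiningSet hn0] at hz
  obtain ⟨x, k, h1, h2, rfl⟩ := hz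
  intro hd
  have e1 : n ∣ x * q ^ (k % m) + t := by
    have : t + x * q ^ k % n ≡ t + x * q ^ (k % m) [MOD n] :=
      ((Nat.mod_modEq _ _).trans (mul_pow_modEq_mul_pow_mod hqm x k)).add_left t
    rw [add_comm]
    exact (Nat.ModEq.dvd_iff this dvd_rfl).1 hd
  have e2 := Nat.mul_dvd_mul_right e1 N
  rw [hnN, add_mul, mul_right_comm] at e2
  exact not_dvd_mul_pow_add (by omega) hM hh hX (Nat.mul_le_mul_right _ (by omega))
    (Nat.mul_le_mul_right _ (by omega)) (by positivity) (Nat.mod_lt _ hm0) e2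

/-- Multiplying `w + z` by a power of `q` turns `w ∈ C_y` into its representative `y < δ` and keeps
`z` in its coset, which reduces to the preceding lemma. -/
theorem disjoint_neg_bchDefiningSet {n q m δ z w : ℕ} (hq : 2 ≤ q)
    (hqm : q ^ m ≡ 1 [MOD n]) (hδ : 2 ≤ δ) (hδmax : δ ≤ deltaMax n q m)
    (hz : z ∈ bchDefiningSet n q 1 δ) (hw : w ∈ bchDefiningSet n q 1 δ) : ¬ n ∣ w + z := by
  obtain ⟨hn0, hm0, -⟩ := exists_of_two_le_deltaMax hq hqm (hδ.trans hδmax)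
  rw [mem_bchDefiningSet hn0] at hw hz
  obtain ⟨y, l, h1, h2, rfl⟩ := hw
  obtain ⟨x, k, h3, h4, rfl⟩ := hz
  intro hd
  -- The exponent `l * m - l` inverts `q^l` modulo `n`, because `q^(l * m) ≡ 1`.
  have hl : l ≤ l * m := Nat.le_mul_of_pos_right _ hm0
  have e1 : y + x * q ^ (k + (l * m - l)) % n ≡
      (y * q ^ l % n + x * q ^ k % n) * q ^ (l * m - l) [MOD n] := by
    have e2 : (y * q ^ l % n + x * q ^ k % n) * q ^ (l * m - l) ≡
        (y * q ^ l + x * q ^ k) * q ^ (l * m - l) [MOD n] :=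
      ((Nat.mod_modEq _ _).add (Nat.mod_modEq _ _)).mul_right _
    refine Nat.ModEq.trans ?_ e2.symm
    rw [add_mul, mul_assoc, mul_assoc, ← pow_add, ← pow_add, Nat.add_sub_cancel' hl]
    refine Nat.ModEq.add ?_ (Nat.mod_modEq _ _)
    rw [mul_comm l m, pow_mul]
    simpa using ((hqm.pow l).mul_left y).symm
  have e2 := (Nat.ModEq.dvd_iff e1 dvd_rfl).2 (hd.mul_right _)
  exact not_dvd_add_of_mem_bchDefiningSet hq hqm hδ hδmax
    ((mem_bchDefiningSet hn0).2 ⟨x, _, h3, h4, rfl⟩) (by omega) e2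

/-- With `d = δ - 1`, the count is `d - ⌊d/q⌋ = ⌈d - d/q⌉`. -/
theorem card_filter_not_dvd_Ico {q δ : ℕ} (hδ : 1 ≤ δ) :
    (((Finset.Ico 1 δ).filter fun x => ¬ q ∣ x).card : ℤ) =
      ⌈((δ : ℚ) - 1) * (1 - 1 / (q : ℚ))⌉ := by
  obtain ⟨d, rfl⟩ : ∃ d, δ = d + 1 := ⟨δ - 1, by omega⟩
  have hI : Finset.Ico 1 (d + 1) = Finset.Ioc 0 d := by ext; simp; omega
  have h1 := Finset.card_filter_add_card_filter_not (s := Finset.Ioc 0 d) (fun x => q ∣ x)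
  rw [Nat.Ioc_filter_dvd_card_eq_div, Nat.card_Ioc] at h1
  have h2 : (((d + 1 : ℕ) : ℚ) - 1) * (1 - 1 / (q : ℚ)) = -(((d : ℤ) : ℚ) / (q : ℚ)) + (d : ℤ) := by
    push_cast; ring
  rw [hI, h2, Int.ceil_add_intCast, Int.ceil_neg, Rat.floor_intCast_div_natCast]
  have h3 : ((d / q : ℕ) : ℤ) = (d : ℤ) / q := by simp
  omega

/-! ### Cyclic codes -/

section CyclicCode

variable {F K : Type*} [Field F] [Field K] [Algebra F K] {n : ℕ} {α : K} {Z : Finset ℕ}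

theorem wordPolynomial_coeff (c : Fin n → F) (i : Fin n) : (wordPolynomial c).coeff i = c i := by
  simp only [wordPolynomial, finsetSum_coeff, coeff_C_mul, coeff_X_pow]
  rw [Finset.sum_eq_single i] <;> simp +contextual [Fin.ext_iff, eq_comm]

theorem wordPolynomial_degree_lt (c : Fin n → F) : (wordPolynomial c).degree < n := by
  rw [← mem_degreeLT]
  refine Submodule.sum_mem _ fun i _ => ?_
  rw [mem_degreeLT]
  exact lt_of_le_of_lt (degree_C_mul_X_pow_le _ _) (by exact_mod_cast i.2)

theorem wordPolynomial_coeff_eq {f : F[X]} (hf : f.degree < n) :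
    wordPolynomial (fun i : Fin n => f.coeff i) = f := by
  ext j
  by_cases hj : j < n
  · exact wordPolynomial_coeff _ ⟨j, hj⟩
  · have hj' : (n : WithBot ℕ) ≤ j := by exact_mod_cast not_lt.1 hj
    rw [coeff_eq_zero_of_degree_lt ((wordPolynomial_degree_lt _).trans_le hj'),
      coeff_eq_zero_of_degree_lt (hf.trans_le hj')]

/-- `wordPolynomial` as a linear map. -/
noncomputable def wordPolynomialHom (F : Type*) [Field F] (n : ℕ) : (Fin n → F) →ₗ[F] F[X] where
  toFun := wordPolynomial
  map_add' c d := by simp [wordPolynomial, add_mul, Finset.sum_add_distrib]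
  map_smul' r c := by simp [wordPolynomial, Finset.mul_sum, mul_assoc, smul_eq_C_mul]

theorem rootPolynomial_monic (α : K) (Z : Finset ℕ) : (rootPolynomial α Z).Monic :=
  monic_prod_X_sub_C _ _

theorem rootPolynomial_natDegree (α : K) (Z : Finset ℕ) :
    (rootPolynomial α Z).natDegree = Z.card := by
  rw [rootPolynomial, natDegree_finsetProd_X_sub_C_eq_card]

theorem rootPolynomial_dvd_iff (hα : IsPrimitiveRoot α n) (hZ : Z ⊆ Finset.range n) (f : K[X]) :
    rootPolynomial α Z ∣ f ↔ ∀ z ∈ Z, f.eval (α ^ z) = 0 := by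
  constructor
  · intro h z hz
    rw [← IsRoot.def, ← dvd_iff_isRoot]
    exact (Finset.dvd_prod_of_mem (fun z => X - C (α ^ z)) hz).trans h
  · intro h
    refine Finset.prod_dvd_of_coprime ?_ fun z hz => dvd_iff_isRoot.2 (h z hz)
    intro z hz w hw hzw
    refine isCoprime_X_sub_C_of_isUnit_sub (sub_ne_zero.2 fun e => hzw ?_).isUnit
    exact hα.pow_inj (Finset.mem_range.1 (hZ hz)) (Finset.mem_range.1 (hZ hw)) e

theorem eval_map_wordPolynomial (c : Fin n → F) (x : K) :
    ((wordPolynomial c).map (algebraMap F K)).eval x =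
      ∑ i : Fin n, algebraMap F K (c i) * x ^ (i : ℕ) := by
  simp [wordPolynomial, Polynomial.map_sum, eval_finsetSum]

theorem mem_cyclicCode_iff (hα : IsPrimitiveRoot α n) (hZ : Z ⊆ Finset.range n) (c : Fin n → F) :
    c ∈ cyclicCode F n α Z ↔ ∀ z ∈ Z, ∑ i : Fin n, algebraMap F K (c i) * (α ^ z) ^ (i : ℕ) = 0 := by
  change rootPolynomial α Z ∣ _ ↔ _
  rw [rootPolynomial_dvd_iff hα hZ]
  simp_rw [eval_map_wordPolynomial]

theorem mem_range_algebraMap_of_pow_card_eq [Fintype F] {x : K} (hx : x ^ Fintype.card F = x) :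
    x ∈ Set.range (algebraMap F K) := by
  have h1 : (∏ a : F, (X - C a) : F[X]) = X ^ Fintype.card F - X := by
    have hs := FiniteField.roots_X_pow_card_sub_X F
    have hm : (X ^ Fintype.card F - X : F[X]).Monic :=
      monic_X_pow_sub (by simpa using Fintype.one_lt_card)
    have := prod_multiset_X_sub_C_of_monic_of_roots_card_eq hm (by
      rw [hs, FiniteField.X_pow_card_sub_X_natDegree_eq F Fintype.one_lt_card]; rfl)
    rw [hs] at this
    exact this
  have h2 := congrArg (aeval x) h1
  simp only [map_prod, map_sub, aeval_X, aeval_C, map_pow, hx, sub_self] at h2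
  obtain ⟨a, -, ha⟩ := Finset.prod_eq_zero_iff.1 h2
  exact ⟨a, (sub_eq_zero.1 ha).symm⟩

/-- The generator polynomial of a cyclic code over `F` descends to `F`. -/
theorem exists_map_eq_rootPolynomial [Fintype F] (hn : n.Coprime (Fintype.card F))
    (hα : IsPrimitiveRoot α n) (hZ : Z ⊆ Finset.range n)
    (hZq : ∀ z ∈ Z, z * Fintype.card F % n ∈ Z) :
    ∃ g : F[X], g.map (algebraMap F K) = rootPolynomial α Z ∧ g.natDegree = Z.card ∧ g.Monic := by
  set q := Fintype.card F with hq
  -- Multiplication by `q` permutes `Z`, so the Frobenius `x ↦ x^q` permutes the linear factors and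
  -- fixes the coefficients of their product.
  have hinj : Set.InjOn (fun z => z * q % n) (Z : Set ℕ) := by
    intro z hz w hw e
    have := Nat.ModEq.cancel_right_of_coprime hn e
    exact Nat.ModEq.eq_of_lt_of_lt this (Finset.mem_range.1 (hZ hz)) (Finset.mem_range.1 (hZ hw))
  have himg : Z.image (fun z => z * q % n) = Z :=
    Finset.eq_of_subset_of_card_le (Finset.image_subset_iff.2 hZq)
      (Finset.card_image_of_injOn hinj).ge
  let φ : K →+* K := (FiniteField.frobeniusAlgHom F K : K →+* K)
  have hφ : ∀ x, φ x = x ^ q := fun x => by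
    simp [φ, hq, FiniteField.frobeniusAlgHom_apply]
  have hfix : (rootPolynomial α Z).map φ = rootPolynomial α Z := by
    conv_rhs => rw [rootPolynomial, ← himg, Finset.prod_image hinj]
    rw [rootPolynomial, Polynomial.map_prod]
    refine Finset.prod_congr rfl fun z _ => ?_
    rw [Polynomial.map_sub, map_X, map_C, hφ, ← pow_mul, ← pow_mod_orderOf α (z * q),
      ← hα.eq_orderOf]
  have hl : rootPolynomial α Z ∈ lifts (algebraMap F K) := by
    rw [lifts_iff_coeff_lifts]
    intro j
    refine mem_range_algebraMap_of_pow_card_eq ?_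
    rw [← hq, ← hφ, ← coeff_map, hfix]
  obtain ⟨g, h1, h2, h3⟩ := lifts_and_natDegree_eq_and_monic hl (rootPolynomial_monic α Z)
  exact ⟨g, h1, h2.trans (rootPolynomial_natDegree α Z), h3⟩

theorem mem_cyclicCode_iff_dvd {g : F[X]} (hg : g.map (algebraMap F K) = rootPolynomial α Z)
    (c : Fin n → F) : c ∈ cyclicCode F n α Z ↔ g ∣ wordPolynomial c := by
  change rootPolynomial α Z ∣ _ ↔ _
  rw [← hg, map_dvd_map']

/-- Rank–nullity for reduction modulo `g`: the kernel is the code and the image is all polynomials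
of degree less than `deg g`. -/
theorem finrank_cyclicCode {g : F[X]} (hg : g.map (algebraMap F K) = rootPolynomial α Z)
    (hgm : g.Monic) (hgd : g.natDegree = Z.card) (hZ : Z.card ≤ n) :
    Module.finrank F (cyclicCode F n α Z) = n - Z.card := by
  have hdeg : g.degree = Z.card := by rw [degree_eq_natDegree hgm.ne_zero, hgd]
  let ψ : (Fin n → F) →ₗ[F] F[X] := (modByMonicHom g).comp (wordPolynomialHom F n)
  have hψ : ∀ c, ψ c = wordPolynomial c %ₘ g := fun c => rfl
  have hker : LinearMap.ker ψ = cyclicCode F n α Z := by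
    ext c
    rw [LinearMap.mem_ker, hψ, modByMonic_eq_zero_iff_dvd hgm, mem_cyclicCode_iff_dvd hg]
  have hrange : LinearMap.range ψ = degreeLT F Z.card := by
    ext f
    rw [mem_degreeLT, LinearMap.mem_range]
    constructor
    · rintro ⟨c, rfl⟩
      rw [hψ, ← hdeg]
      exact degree_modByMonic_lt _ hgm
    · intro hf
      refine ⟨fun i => f.coeff i, ?_⟩
      rw [hψ, wordPolynomial_coeff_eq (hf.trans_le (by exact_mod_cast hZ)),
        (modByMonic_eq_self_iff hgm).2 (hdeg ▸ hf)]
  have h := LinearMap.finrank_range_add_finrank_ker ψ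
  rw [hker, hrange, (degreeLTEquiv F Z.card).finrank_eq, Module.finrank_fin_fun,
    Module.finrank_fin_fun] at h
  omega

/-- A word in the dual of a cyclic code vanishes at `α ^ t` unless `-t` lies in the defining
set. -/
theorem sum_eq_zero_of_mem_euclideanDual_cyclicCode {g : F[X]}
    (hg : g.map (algebraMap F K) = rootPolynomial α Z) (hα : IsPrimitiveRoot α n) (hZ : Z ⊆ Finset.range n) {y : Fin n → F}
    (hy : y ∈ euclideanDual (cyclicCode F n α Z)) {t : ℕ} (ht : ∀ z ∈ Z, ¬ n ∣ t + z) :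
    ∑ i : Fin n, algebraMap F K (y i) * (α ^ t) ^ (i : ℕ) = 0 := by
  let L : K[X] →ₗ[K] K :=
    ∑ i : Fin n, algebraMap F K (y i) • lcoeff K (i : ℕ)
  have hL : ∀ f, L f = ∑ i : Fin n, algebraMap F K (y i) * f.coeff i := fun f => by
    simp [L, Algebra.smul_def]
  -- The desired sum is the pairing of `y` with the word of powers of `α^t`. At `α^z` that word is a
  -- geometric sum with ratio `α^(t+z) ≠ 1`, hence zero.
  let v : K[X] := wordPolynomial fun i : Fin n => (α ^ t) ^ (i : ℕ)
  have hv : rootPolynomial α Z ∣ v := by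
    rw [rootPolynomial_dvd_iff hα hZ]
    intro z hz
    have h1 : v.eval (α ^ z) = ∑ i ∈ Finset.range n, (α ^ (t + z)) ^ i := by
      rw [Finset.sum_range]
      simp [v, wordPolynomial, eval_finsetSum, pow_add, mul_pow]
    rw [h1]
    have h2 : α ^ (t + z) ≠ 1 := fun e => ht z hz (hα.dvd_of_pow_eq_one _ e)
    have h3 := mul_geom_sum (α ^ (t + z)) n
    rw [← pow_mul, mul_comm (t + z), pow_mul, hα.pow_eq_one, one_pow, sub_self] at h3
    exact (mul_eq_zero.1 h3).resolve_left (sub_ne_zero.2 h2)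
  obtain ⟨h, hh⟩ := hv
  have hLv : L v = 0 := by
    rw [hh]
    -- The word `v` has coefficients in `K`, while `y` is only known to annihilate codewords over
    -- `F`. Expanding the cofactor `h` writes `v` as a `K`-combination of the `F`-codewords `g X^j`.
    conv_lhs => rw [h.as_sum_support_C_mul_X_pow, Finset.mul_sum, map_sum]
    refine Finset.sum_eq_zero fun j hj => ?_
    have hdeg : (g * X ^ j).degree < (n : WithBot ℕ) := by
      have h1 : h ≠ 0 := by rintro rfl; simp at hj
      have h2 : (rootPolynomial α Z * h).degree < (n : WithBot ℕ) := hh ▸ wordPolynomial_degree_lt _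
      rw [← degree_map (g * X ^ j) (algebraMap F K), Polynomial.map_mul, Polynomial.map_pow, map_X, hg]
      refine lt_of_le_of_lt ?_ h2
      rw [degree_mul, degree_mul, degree_X_pow]
      gcongr
      exact le_degree_of_mem_supp j hj
    have hmem : (fun i : Fin n => (g * X ^ j).coeff i) ∈ cyclicCode F n α Z := by
      rw [mem_cyclicCode_iff_dvd hg, wordPolynomial_coeff_eq hdeg]
      exact dvd_mul_right _ _
    have h0 := congrArg (algebraMap F K) (hy _ hmem)
    have e : rootPolynomial α Z * (C (h.coeff j) * X ^ j) =
        h.coeff j • (g * X ^ j).map (algebraMap F K) := by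
      rw [Polynomial.map_mul, Polynomial.map_pow, map_X, hg, smul_eq_C_mul]; ring
    rw [e, map_smul, hL, smul_eq_mul]
    simp only [dotProduct, map_sum, map_mul, map_zero] at h0
    simp only [coeff_map]
    rw [Finset.sum_congr rfl fun i _ => mul_comm (algebraMap F K (y i)) _, h0, mul_zero]
  rw [hL] at hLv
  rw [← hLv]
  exact Finset.sum_congr rfl fun i _ => by rw [wordPolynomial_coeff]

open Classical in
/-- The BCH bound. -/
theorem lt_card_support_of_sum_eq_zero (hα : IsPrimitiveRoot α n) {y : Fin n → F} {b r : ℕ}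
    (hy : ∀ t, b ≤ t → t < b + r → ∑ i : Fin n, algebraMap F K (y i) * (α ^ t) ^ (i : ℕ) = 0)
    (hy0 : y ≠ 0) : r < (Finset.univ.filter fun i => y i ≠ 0).card := by
  by_contra! hcard
  obtain ⟨i₀, hi₀⟩ := Function.ne_iff.1 hy0
  set S := Finset.univ.filter fun i => y i ≠ 0 with hS
  -- `P` vanishes at every support position except `i₀` and has degree `|S| - 1 < r`. Combining the
  -- vanishing sums with its coefficients therefore isolates the single nonzero term at `i₀`.
  let P : K[X] := ∏ i ∈ S.erase i₀, (X - C (α ^ (i : ℕ)))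
  have hi₀S : i₀ ∈ S := by simpa [hS] using hi₀
  have hPdeg : P.natDegree < r := by
    rw [natDegree_finsetProd_X_sub_C_eq_card, Finset.card_erase_of_mem hi₀S]
    have := Finset.card_pos.2 ⟨_, hi₀S⟩
    omega
  have hsum : ∑ i : Fin n, algebraMap F K (y i) * (α ^ (i : ℕ)) ^ b * P.eval (α ^ (i : ℕ)) = 0 := by
    simp_rw [eval_eq_sum_range, Finset.mul_sum]
    rw [Finset.sum_comm]
    refine Finset.sum_eq_zero fun j hj => ?_
    have hj' := Finset.mem_range.1 hj
    have := hy (b + j) (by omega) (by omega)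
    calc _ = P.coeff j * ∑ i : Fin n, algebraMap F K (y i) * (α ^ (b + j)) ^ (i : ℕ) := by
          rw [Finset.mul_sum]
          refine Finset.sum_congr rfl fun i _ => ?_
          ring
      _ = 0 := by rw [this, mul_zero]
  have hn : 0 < n := i₀.pos
  have hα0 : α ≠ 0 := hα.ne_zero hn.ne'
  rw [Finset.sum_eq_single i₀] at hsum
  · have h1 : P.eval (α ^ (i₀ : ℕ)) ≠ 0 := by
      rw [eval_prod, Finset.prod_ne_zero_iff]
      intro i hi
      rw [eval_sub, eval_X, eval_C, sub_ne_zero]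
      intro e
      exact Finset.ne_of_mem_erase hi (Fin.ext (hα.pow_inj i₀.2 i.2 e).symm)
    have h2 : algebraMap F K (y i₀) ≠ 0 := by simpa using hi₀
    exact mul_ne_zero (mul_ne_zero h2 (pow_ne_zero _ (pow_ne_zero _ hα0))) h1 hsum
  · intro i _ hi
    by_cases hiS : i ∈ S
    · have : P.eval (α ^ (i : ℕ)) = 0 := by
        rw [eval_prod]
        exact Finset.prod_eq_zero (Finset.mem_erase.2 ⟨hi, hiS⟩) (by simp)
      rw [this, mul_zero]
    · have : y i = 0 := by simpa [hS] using hiS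
      simp [this]
  · simp

end CyclicCode

/-! ### CSS codes -/

/-- The uniform superposition of the coset `x₀ + C`. -/
noncomputable def cosetState {F : Type*} [Field F] {n : ℕ} (C : Submodule F (Fin n → F))
    (x₀ : Fin n → F) : QState F n :=
  open Classical in WithLp.toLp 2 fun x => if x - x₀ ∈ C then 1 else 0

theorem cosetState_apply_of_mem {F : Type*} [Field F] {n : ℕ}
    {C : Submodule F (Fin n → F)} {x₀ x : Fin n → F}
    (h : x - x₀ ∈ C) : cosetState C x₀ x = 1 := by
  simp [cosetState, h]

theorem cosetState_apply_of_notMem {F : Type*} [Field F] {n : ℕ}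
    {C : Submodule F (Fin n → F)} {x₀ x : Fin n → F}
    (h : x - x₀ ∉ C) : cosetState C x₀ x = 0 := by
  simp [cosetState, h]

/-- An error that commutes up to the nontrivial scalar `l` with an isometry fixing `Q` pointwise
maps `Q` to its orthogonal complement. -/
theorem detects_of_commute_smul {F : Type*} [Fintype F] {n : ℕ}
    {Q : Submodule ℂ (QState F n)} {S E : Module.End ℂ (QState F n)}
    (hS : ∀ u v, inner ℂ (S u) (S v) = (inner ℂ u v : ℂ))
    (hQ : ∀ v ∈ Q, S v = v) {l : ℂ} (hl : l ≠ 1)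
    (hSE : S * E = l • (E * S)) : Detects Q E := by
  refine ⟨0, fun u hu v hv => ?_⟩
  have h1 : S (E v) = l • E v := by
    have := LinearMap.congr_fun hSE v
    simpa [hQ v hv] using this
  have h2 : inner ℂ u (E v) = l * (inner ℂ u (E v) : ℂ) := by
    conv_lhs => rw [← hS, hQ u hu, h1, inner_smul_right]
  have h3 : (l - 1) * (inner ℂ u (E v) : ℂ) = 0 := by linear_combination -h2
  rw [zero_mul]
  exact (mul_eq_zero.1 h3).resolve_left (sub_ne_zero.2 hl)

section CSS

variable {p : ℕ} [Fact p.Prime] {F : Type*} [Field F] [Fintype F] [Algebra (ZMod p) F] {n : ℕ}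

theorem opX_apply (a : Fin n → F) (f : QState F n) (x : Fin n → F) : opX a f x = f (x - a) := rfl

theorem opZ_apply (b : Fin n → F) (f : QState F n) (x : Fin n → F) :
    opZ p b f x = ZMod.stdAddChar (Algebra.trace (ZMod p) F (b ⬝ᵥ x)) * f x := rfl

theorem opX_eq_errorOp (a : Fin n → F) : opX a = errorOp p 0 a 0 := by
  ext f x
  simp [errorOp_apply, opX_apply]

theorem opZ_eq_errorOp (b : Fin n → F) : opZ p b = errorOp p 0 0 b := by
  ext f x
  simp [errorOp_apply, opZ_apply]

variable (p) in
theorem exists_stdAddChar_trace_ne_one {c : F} (hc : c ≠ 0) :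
    ∃ r : F, (ZMod.stdAddChar (Algebra.trace (ZMod p) F (r * c)) : ℂ) ≠ 1 := by
  have : FiniteDimensional (ZMod p) F := Module.Finite.of_finite
  obtain ⟨s, hs⟩ := Algebra.trace_surjective (ZMod p) F 1
  refine ⟨s / c, ?_⟩
  rw [div_mul_cancel₀ _ hc, hs]
  intro h
  have := ZMod.injective_stdAddChar (h.trans (AddChar.map_zero_eq_one ZMod.stdAddChar).symm)
  exact one_ne_zero this

variable (p) in
/-- A vector pairing trivially under the trace character with a code lies in its dual. -/
theorem mem_euclideanDual_of_stdAddChar {C : Submodule F (Fin n → F)} {y : Fin n → F}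
    (h : ∀ x ∈ C, (ZMod.stdAddChar (Algebra.trace (ZMod p) F (x ⬝ᵥ y)) : ℂ) = 1) :
    y ∈ euclideanDual C := by
  intro x hx
  by_contra hne
  -- Closure of `C` under `F`-scalars upgrades triviality of the trace character to vanishing of the
  -- product itself.
  obtain ⟨r, hr⟩ := exists_stdAddChar_trace_ne_one p hne
  exact hr (by simpa [smul_dotProduct] using h (r • x) (C.smul_mem r hx))

/-- The operators `Z(b)` confine the support to `D^⊥⊥ = D`, and the operators `X(a)` force
invariance under `D^⊥`. The code thus becomes a space of functions on `D/D^⊥`. -/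
theorem mem_cssCode_euclideanDual_iff {D : Submodule F (Fin n → F)} {v : QState F n} :
    v ∈ cssCode p (euclideanDual D) D ↔
      (∀ a ∈ euclideanDual D, ∀ x, v (x - a) = v x) ∧ ∀ x ∉ D, v x = 0 := by
  constructor
  · intro hv
    refine ⟨fun a ha x => ?_, fun x hx => ?_⟩
    · have := hv (opX a) (Or.inl ⟨a, ha, rfl⟩)
      rw [← opX_apply, this]
    · by_contra hne
      refine hx (euclideanDual_euclideanDual D ▸ mem_euclideanDual_of_stdAddChar p fun b hb => ?_)
      have := congrArg (fun w : QState F n => w x) (hv (opZ p b) (Or.inr ⟨b, hb, rfl⟩))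
      simp only [opZ_apply] at this
      exact mul_right_cancel₀ hne (this.trans (one_mul _).symm)
  · rintro ⟨h1, h2⟩ E (⟨a, ha, rfl⟩ | ⟨b, hb, rfl⟩)
    · ext x
      rw [opX_apply, h1 a ha]
    · ext x
      rw [opZ_apply]
      by_cases hx : x ∈ D
      · rw [dotProduct_comm, hb x hx]; simp
      · rw [h2 x hx, mul_zero]

theorem cosetState_mem_cssCode {D : Submodule F (Fin n → F)} (hD : euclideanDual D ≤ D)
    {x₀ : Fin n → F} (hx₀ : x₀ ∈ D) :
    cosetState (euclideanDual D) x₀ ∈ cssCode p (euclideanDual D) D := by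
  rw [mem_cssCode_euclideanDual_iff]
  refine ⟨fun a ha x => ?_, fun x hx => cosetState_apply_of_notMem fun h => hx ?_⟩
  · by_cases h : x - x₀ ∈ euclideanDual D
    · rw [cosetState_apply_of_mem h, cosetState_apply_of_mem]
      rw [sub_right_comm]; exact Submodule.sub_mem _ h ha
    · rw [cosetState_apply_of_notMem h, cosetState_apply_of_notMem]
      intro h'
      rw [sub_right_comm] at h'
      exact h ((Submodule.sub_mem_iff_left _ ha).1 h')
  · simpa using D.add_mem (hD h) hx₀

theorem finrank_cssCode {D : Submodule F (Fin n → F)} (hD : euclideanDual D ≤ D) :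
    Module.finrank ℂ (cssCode p (euclideanDual D) D) =
      Fintype.card F ^ (Module.finrank F D - Module.finrank F (euclideanDual D)) := by
  classical
  let A := (euclideanDual D).submoduleOf D
  let Φ : ((D ⧸ A) → ℂ) →ₗ[ℂ] QState F n :=
    { toFun := fun g => WithLp.toLp 2 fun x => if h : x ∈ D then g (A.mkQ ⟨x, h⟩) else 0
      map_add' := fun g g' => by ext x; by_cases h : x ∈ D <;> simp [h]
      map_smul' := fun r g => by ext x; by_cases h : x ∈ D <;> simp [h] }
  have hΦ : ∀ g x (h : x ∈ D), Φ g x = g (A.mkQ ⟨x, h⟩) := fun g x h => by simp [Φ, h]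
  have hΦ0 : ∀ g x, x ∉ D → Φ g x = 0 := fun g x h => by simp [Φ, h]
  have hinj : Function.Injective Φ := by
    intro g g' e
    ext c
    obtain ⟨⟨x, hx⟩, rfl⟩ := A.mkQ_surjective c
    exact (hΦ g x hx).symm.trans ((congrArg (fun w : QState F n => w x) e).trans (hΦ g' x hx))
  have hrange : LinearMap.range Φ = cssCode p (euclideanDual D) D := by
    ext v
    rw [mem_cssCode_euclideanDual_iff]
    constructor
    · rintro ⟨g, rfl⟩
      refine ⟨fun a ha x => ?_, hΦ0 g⟩
      by_cases hx : x ∈ D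
      · have hxa : x - a ∈ D := D.sub_mem hx (hD ha)
        rw [hΦ g x hx, hΦ g _ hxa]
        congr 1
        refine (Submodule.Quotient.eq A).2 ?_
        change x - a - x ∈ euclideanDual D
        rw [sub_sub_cancel_left]
        exact neg_mem ha
      · have hxa : x - a ∉ D := fun h => hx ((D.sub_mem_iff_left (hD ha)).1 h)
        rw [hΦ0 g x hx, hΦ0 g _ hxa]
    · rintro ⟨h1, h2⟩
      -- Any section of the quotient map serves, since `v` is constant on cosets of `D^⊥`.
      refine ⟨fun c => v (Function.surjInv A.mkQ_surjective c : D), ?_⟩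
      ext x
      by_cases hx : x ∈ D
      · rw [hΦ _ x hx]
        set w := Function.surjInv A.mkQ_surjective (A.mkQ ⟨x, hx⟩) with hw
        have e : A.mkQ ⟨x, hx⟩ = A.mkQ w := (Function.surjInv_eq A.mkQ_surjective _).symm
        have e2 := (Submodule.Quotient.eq A).1 e
        have e3 : x - w ∈ euclideanDual D := e2
        simpa using h1 _ e3 x
      · rw [hΦ0 _ x hx, h2 x hx]
  have : Fintype (D ⧸ A) := Fintype.ofFinite _
  rw [← hrange, LinearMap.finrank_range_of_inj hinj, Module.finrank_fintype_fun_eq_card,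
    Module.card_eq_pow_finrank (K := F)]
  congr 1
  have h := Submodule.finrank_quotient_add_finrank A
  rw [(Submodule.submoduleOfEquivOfLe hD).finrank_eq] at h
  omega

theorem cssCode_ne_bot {D : Submodule F (Fin n → F)} (hD : euclideanDual D ≤ D) :
    cssCode p (euclideanDual D) D ≠ ⊥ := by
  intro h
  have h1 := cosetState_mem_cssCode (p := p) hD D.zero_mem
  rw [h, Submodule.mem_bot] at h1
  have h2 : cosetState (euclideanDual D) 0 0 = 1 := cosetState_apply_of_mem (by simp)
  rw [h1] at h2
  simp at h2

variable (p) in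
/-- The stabilizer group `{X(a) Z(b) | a, b ∈ D^⊥}` of the CSS code of `D^⊥ ⊆ D`. -/
noncomputable def cssStabilizer (D : Submodule F (Fin n → F)) (hD : euclideanDual D ≤ D) :
    Subgroup (Module.End ℂ (QState F n))ˣ where
  carrier := {g | ∃ a ∈ euclideanDual D, ∃ b ∈ euclideanDual D,
    (g : Module.End ℂ (QState F n)) = errorOp p 0 a b}
  one_mem' := ⟨0, zero_mem _, 0, zero_mem _, by rw [errorOp_zero]; rfl⟩
  mul_mem' := by
    rintro g h ⟨a, ha, b, hb, hg⟩ ⟨a', ha', b', hb', hh⟩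
    refine ⟨a + a', add_mem ha ha', b + b', add_mem hb hb', ?_⟩
    rw [Units.val_mul, hg, hh, errorOp_mul, ha' b (hD hb)]
    simp
  inv_mem' := by
    rintro g ⟨a, ha, b, hb, hg⟩
    refine ⟨-a, neg_mem ha, -b, neg_mem hb, ?_⟩
    rw [Units.inv_eq_of_mul_eq_one_right]
    rw [hg, errorOp_mul, ← errorOp_zero p, dotProduct_neg, ha b (hD hb)]
    simp

/-- The group contains the defining operators as the elements with `b = 0` or `a = 0`, and each of
its elements is a product `X(a) Z(b)` of two of them. -/
theorem isStabilizerCode_cssCode {D : Submodule F (Fin n → F)} (hD : euclideanDual D ≤ D) :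
    IsStabilizerCode p (cssCode p (euclideanDual D) D) := by
  refine ⟨cssCode_ne_bot hD, cssStabilizer p D hD, ?_, ?_⟩
  · rintro g ⟨a, -, b, -, hg⟩
    exact ⟨0, a, b, hg⟩
  · have hunit : ∀ a ∈ euclideanDual D, ∀ b ∈ euclideanDual D, errorOp p 0 a b ∈
        Units.val '' (cssStabilizer p D hD : Set (Module.End ℂ (QState F n))ˣ) := by
      intro a ha b hb
      have hmul : ∀ a ∈ euclideanDual D, ∀ b ∈ euclideanDual D,
          errorOp p 0 a b * errorOp p 0 (-a) (-b) = 1 := by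
        intro a ha b hb
        rw [errorOp_mul, ← errorOp_zero p, dotProduct_neg, ha b (hD hb)]
        simp
      refine ⟨⟨errorOp p 0 a b, errorOp p 0 (-a) (-b), hmul a ha b hb, ?_⟩,
        ⟨a, ha, b, hb, rfl⟩, rfl⟩
      simpa using hmul (-a) (neg_mem ha) (-b) (neg_mem hb)
    refine le_antisymm ?_ ?_
    · rintro v hv E ⟨g, ⟨a, ha, b, hb, hg⟩, rfl⟩
      have e : errorOp p 0 a b = opX a * opZ p b := by simp [errorOp]
      rw [hg, e, Module.End.mul_apply, hv (opZ p b) (Or.inr ⟨b, hb, rfl⟩),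
        hv (opX a) (Or.inl ⟨a, ha, rfl⟩)]
    · rintro v hv E (⟨a, ha, rfl⟩ | ⟨b, hb, rfl⟩)
      · rw [opX_eq_errorOp (p := p)]
        exact hv _ (hunit a ha 0 (zero_mem _))
      · rw [opZ_eq_errorOp]
        exact hv _ (hunit 0 (zero_mem _) b hb)

theorem inner_opX (a : Fin n → F) (u v : QState F n) :
    inner ℂ (opX a u) (opX a v) = inner ℂ u v := by
  simp only [PiLp.inner_apply, opX_apply]
  exact (Equiv.subRight a).sum_comp fun x => inner ℂ (u x) (v x)

theorem inner_opZ (b : Fin n → F) (u v : QState F n) :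
    inner ℂ (opZ p b u) (opZ p b v) = inner ℂ u v := by
  simp only [PiLp.inner_apply, opZ_apply]
  refine Finset.sum_congr rfl fun x _ => ?_
  set w : ℂ := ZMod.stdAddChar (Algebra.trace (ZMod p) F (b ⬝ᵥ x))
  have hw : (starRingEnd ℂ) w * w = 1 := by
    rw [← Complex.normSq_eq_conj_mul_self, Complex.normSq_eq_norm_sq]
    simp [w]
  simp only [RCLike.inner_apply, map_mul]
  linear_combination (v x * (starRingEnd ℂ) (u x)) * hw

open Classical in
-- If `b ∉ D = D^⊥⊥`, some `X(-s)` with `s ∈ D^⊥` commutes with the error only up to a nontrivial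
-- scalar; if `a ∉ D`, some `Z(s)` does. If both lie in `D`, the small weight forces `a = b = 0`,
-- and the error is a scalar.
theorem detects_errorOp_cssCode {D : Submodule F (Fin n → F)} {d : ℕ}
    (hd : ∀ y ∈ D, y ≠ 0 → d ≤ (Finset.univ.filter fun i => y i ≠ 0).card)
    (c : ZMod p) (a b : Fin n → F) (hw : errorWeight a b < d) :
    Detects (cssCode p (euclideanDual D) D) (errorOp p c a b) := by
  by_cases ha : a ∈ D
  · by_cases hb : b ∈ D
    · have ha0 : a = 0 := by
        by_contra h
        refine absurd (hd a ha h) (not_le.2 (lt_of_le_of_lt (Finset.card_le_card ?_) hw))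
        intro i; simp +contextual
      have hb0 : b = 0 := by
        by_contra h
        refine absurd (hd b hb h) (not_le.2 (lt_of_le_of_lt (Finset.card_le_card ?_) hw))
        intro i; simp +contextual
      refine ⟨ZMod.stdAddChar c, fun u _ v _ => ?_⟩
      have : errorOp p c a b v = (ZMod.stdAddChar c : ℂ) • v := by
        ext x
        simp [errorOp_apply, ha0, hb0]
      rw [this, inner_smul_right]
    · have : ∃ s ∈ euclideanDual D,
          (ZMod.stdAddChar (Algebra.trace (ZMod p) F (s ⬝ᵥ b)) : ℂ) ≠ 1 := by
        by_contra! h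
        exact hb (euclideanDual_euclideanDual D ▸ mem_euclideanDual_of_stdAddChar p h)
      obtain ⟨s, hs, hne⟩ := this
      refine detects_of_commute_smul (S := opX (-s))
        (l := ZMod.stdAddChar (Algebra.trace (ZMod p) F (s ⬝ᵥ b)))
        (inner_opX _) (fun v hv => hv _ (Or.inl ⟨_, neg_mem hs, rfl⟩)) hne ?_
      ext v x
      have e : x - -s - a = x - a - -s := by abel
      have e2 : b ⬝ᵥ (x - -s - a) = s ⬝ᵥ b + b ⬝ᵥ (x - a) := by
        rw [dotProduct_comm s b, ← dotProduct_add]; congr 1; abel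
      simp only [Module.End.mul_apply, LinearMap.smul_apply, PiLp.smul_apply, smul_eq_mul,
        opX_apply, errorOp_apply]
      rw [e2, map_add, AddChar.map_add_eq_mul, e]
      ring
  · have : ∃ s ∈ euclideanDual D,
        (ZMod.stdAddChar (Algebra.trace (ZMod p) F (s ⬝ᵥ a)) : ℂ) ≠ 1 := by
      by_contra! h
      exact ha (euclideanDual_euclideanDual D ▸ mem_euclideanDual_of_stdAddChar p h)
    obtain ⟨s, hs, hne⟩ := this
    refine detects_of_commute_smul (S := opZ p s)
      (l := ZMod.stdAddChar (Algebra.trace (ZMod p) F (s ⬝ᵥ a)))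
      (inner_opZ _) (fun v hv => hv _ (Or.inr ⟨_, hs, rfl⟩)) hne ?_
    ext v x
    have e : s ⬝ᵥ x = s ⬝ᵥ a + s ⬝ᵥ (x - a) := by
      rw [← dotProduct_add]; congr 1; abel
    simp only [Module.End.mul_apply, LinearMap.smul_apply, PiLp.smul_apply, smul_eq_mul,
      opZ_apply, errorOp_apply]
    rw [e, map_add, AddChar.map_add_eq_mul]
    ring

/-- Test on coset states, evaluated at `x₀ + a`. The phase is nonzero, so `a` must stay in the coset
of `D^⊥`; comparing `x₀ = 0` with an arbitrary `x₀ ∈ D` then makes the character of `b ⬝ x₀`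
trivial. -/
theorem mem_euclideanDual_of_errorOp_fixes {D : Submodule F (Fin n → F)}
    (hD : euclideanDual D ≤ D) {c : ZMod p} {a b : Fin n → F}
    (h : ∀ v ∈ cssCode p (euclideanDual D) D, errorOp p c a b v = v) :
    a ∈ euclideanDual D ∧ b ∈ euclideanDual D := by
  have key : ∀ x₀ ∈ D, (ZMod.stdAddChar c *
      ZMod.stdAddChar (Algebra.trace (ZMod p) F (b ⬝ᵥ x₀)) : ℂ) =
        cosetState (euclideanDual D) x₀ (x₀ + a) := by
    intro x₀ hx₀
    rw [← h _ (cosetState_mem_cssCode hD hx₀), errorOp_apply, add_sub_cancel_right,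
      cosetState_apply_of_mem (x := x₀) (by simp), mul_one]
  have ha : a ∈ euclideanDual D := by
    by_contra hne
    have h0 := key 0 D.zero_mem
    rw [cosetState_apply_of_notMem (by simpa using hne)] at h0
    have hne : ∀ z : ZMod p, (ZMod.stdAddChar z : ℂ) ≠ 0 := fun z hz => by
      have := AddChar.norm_apply (ZMod.stdAddChar (N := p)) z
      rw [hz] at this; simp at this
    exact mul_ne_zero (hne _) (hne _) h0
  refine ⟨ha, mem_euclideanDual_of_stdAddChar p fun x hx => ?_⟩
  have h0 := key 0 D.zero_mem
  have h1 := key x hx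
  rw [cosetState_apply_of_mem (by simpa using ha)] at h0 h1
  simp only [dotProduct_zero, map_zero, AddChar.map_zero_eq_one, mul_one] at h0
  rw [h0, one_mul, dotProduct_comm] at h1
  exact h1

open Classical in
theorem pureTo_cssCode {D : Submodule F (Fin n → F)} (hD : euclideanDual D ≤ D) {d : ℕ}
    (hd : ∀ y ∈ euclideanDual D, y ≠ 0 → d ≤ (Finset.univ.filter fun i => y i ≠ 0).card) :
    PureTo p d (cssCode p (euclideanDual D) D) := by
  intro c a b h hab
  obtain ⟨ha, hb⟩ := mem_euclideanDual_of_errorOp_fixes hD h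
  rcases hab with hab | hab
  · refine (hd a ha hab).trans (Finset.card_le_card ?_)
    intro i; simp +contextual
  · refine (hd b hb hab).trans (Finset.card_le_card ?_)
    intro i; simp +contextual

end CSS

/-! ### Quantum BCH codes -/

theorem mainTheorem10 (p : ℕ) [Fact p.Prime] (F : Type*) [Field F] [Fintype F]
    [Algebra (ZMod p) F] (q n m δ : ℕ) (hq : Fintype.card F = q) (hn : Nat.Coprime n q)
    (hm : m = orderOf (q : ZMod n)) (hδ : 2 ≤ δ) (hδmax : δ ≤ deltaMax n q m) :
    ∃ (k : ℕ) (D : Submodule F (Fin n → F)),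
      (k : ℤ) = (n : ℤ) - 2 * m * ⌈((δ : ℚ) - 1) * (1 - 1 / (q : ℚ))⌉ ∧
      IsNarrowSenseBCH δ D ∧
      euclideanDual D ≤ D ∧
      IsStabilizerCode p (cssCode p (euclideanDual D) D) ∧
      IsQuantumCode p k δ (cssCode p (euclideanDual D) D) ∧
      PureTo p (deltaMax n q m + 1) (cssCode p (euclideanDual D) D) := by
  classical
  subst hq
  have hq2 : 2 ≤ Fintype.card F := Fintype.one_lt_card
  have hqm : Fintype.card F ^ m ≡ 1 [MOD n] := by
    rw [← ZMod.natCast_eq_natCast_iff, hm]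
    push_cast
    exact pow_orderOf_eq_one _
  obtain ⟨hn0, -⟩ := exists_of_two_le_deltaMax hq2 hqm (hδ.trans hδmax)
  -- The characteristic divides `q`, which is coprime to `n`; so a primitive `n`-th root of unity
  -- exists in the algebraic closure.
  have hnF : NeZero (n : F) := ⟨fun h => by
    obtain ⟨r, hr⟩ := CharP.exists F
    have hr1 : r ∣ n := (CharP.cast_eq_zero_iff F r n).1 h
    have hr2 : r ∣ Fintype.card F :=
      (CharP.cast_eq_zero_iff F r _).1 (Nat.cast_card_eq_zero F)
    have hr3 : r = 1 := Nat.dvd_one.1 (hn ▸ Nat.dvd_gcd hr1 hr2)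
    exact CharP.char_ne_one F r hr3⟩
  obtain ⟨α, hα⟩ := HasEnoughRootsOfUnity.exists_primitiveRoot (AlgebraicClosure F) n
  set Z := bchDefiningSet n (Fintype.card F) 1 δ with hZdef
  have hZ : Z ⊆ Finset.range n := bchDefiningSet_subset_range _ _ _ _
  have hZn : Z.card ≤ n := by simpa using Finset.card_le_card hZ
  obtain ⟨g, hg, hgd, hgm⟩ := exists_map_eq_rootPolynomial hn hα hZ
    fun z hz => mul_mod_mem_bchDefiningSet hn0 hz
  set D := cyclicCode F n α Z with hDdef
  have hfD : Module.finrank F D = n - Z.card := finrank_cyclicCode hg hgm hgd hZn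
  have hfA : Module.finrank F (euclideanDual D) = Z.card := by
    rw [finrank_euclideanDual, hfD]; omega
  have hD : euclideanDual D ≤ D := by
    intro y hy
    rw [hDdef, mem_cyclicCode_iff hα hZ]
    intro w hw
    exact sum_eq_zero_of_mem_euclideanDual_cyclicCode hg hα hZ hy
      fun z hz => disjoint_neg_bchDefiningSet hq2 hqm hδ hδmax hz hw
  -- This yields `|Z| ≤ n - |Z|`, so the truncated subtractions in `k = n - |Z| - |Z|` are exact.
  have hle := Submodule.finrank_mono hD
  rw [hfA, hfD] at hle
  have hdist : ∀ y ∈ D, y ≠ 0 → δ ≤ (Finset.univ.filter fun i => y i ≠ 0).card := by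
    intro y hy hy0
    rw [hDdef, mem_cyclicCode_iff hα hZ] at hy
    have := lt_card_support_of_sum_eq_zero hα (b := 1) (r := δ - 1) (fun t h1 h2 => ?_) hy0
    · omega
    · have h := hy (t % n) ((mem_bchDefiningSet hn0).2 ⟨t, 0, h1, by omega, by simp⟩)
      have e : α ^ (t % n) = α ^ t := by
        conv_lhs => rw [hα.eq_orderOf, pow_mod_orderOf]
      rwa [e] at h
  have hdual : ∀ y ∈ euclideanDual D, y ≠ 0 →
      deltaMax n (Fintype.card F) m + 1 ≤ (Finset.univ.filter fun i => y i ≠ 0).card := by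
    intro y hy hy0
    -- Starting at the exponent `0` instead of `1` gives δ_max consecutive zeros, hence weight at
    -- least δ_max + 1.
    refine lt_card_support_of_sum_eq_zero hα (b := 0) (fun t _ h2 => ?_) hy0
    exact sum_eq_zero_of_mem_euclideanDual_cyclicCode hg hα hZ hy
      fun z hz => not_dvd_add_of_mem_bchDefiningSet hq2 hqm hδ hδmax hz (by omega)
  refine ⟨n - Z.card - Z.card, D, ?_, ⟨α, hα, rfl⟩, hD, isStabilizerCode_cssCode hD, ⟨?_, ?_⟩,
    pureTo_cssCode hD hdual⟩
  · rw [← card_filter_not_dvd_Ico (by omega)]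
    have hc := card_bchDefiningSet hq2 hn hqm hδ hδmax
    rw [← hZdef] at hc
    rw [Nat.cast_sub hle, Nat.cast_sub hZn, hc]
    push_cast
    ring
  · rw [finrank_cssCode hD, hfA, hfD]
  · intro c a b hw
    exact detects_errorOp_cssCode hdist c a b hw
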